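/- Let $\alpha,\lambda>0$ and, on $\mathsf G=[0,\infty)$ with its Borel $\sigma$-algebra, let $\pi(\mathrm dx)=\alpha e^{-\alpha x}\,\mathrm dx$ and $\nu(\mathrm dx)=\lambda e^{-\lambda x}\,\mathrm dx$ be the exponential distributions with parameters $\alpha$ and $\lambda$. Let $\varpi(x)=e^{-(\alpha-\lambda)x}$, which is proportional to $\mathrm d\pi/\mathrm d\nu$, put $\mathsf G(t)=\{x\in\mathsf G:\varpi(x)>t\}$, and let $$U(x,A)=\frac1{\varpi(x)}\int_0^{\varpi(x)}\frac{\nu(A\cap\mathsf G(t))}{\nu(\mathsf G(t))}\,\mathrm dt,\qquad x\in\mathsf G,\ A\subseteq\mathsf G\ \text{Borel},$$ be the Markov kernel of the ideal slice sampler. For $f\in L^2(\pi)$ write $(\mathrm Uf)(x)=\int f(y)\,U(x,\mathrm dy)$, $\|f\|_\pi^2=\int f^2\,\mathrm d\pi$ and $\mathcal E_\pi(U,f)=\int (f-\mathrm Uf)\,f\,\mathrm d\pi$, and let $L^2_0(\pi)=\{f\in L^2(\pi):\int f\,\mathrm d\pi=0\}$. Then $$\inf_{f\in L^2_0(\pi),\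 \|f\|_\pi=1}\mathcal E_\pi(U,f)\ \ge\ \begin{cases}\dfrac{\alpha+\lambda}{2\alpha}, & \alpha\ge\lambda,\\[2mm] \Big(\dfrac{\alpha}{2\lambda-\alpha}\Big)^2, & \alpha<\lambda.\end{cases}$$ -/

import Mathlib

open MeasureTheory ProbabilityTheory
open scoped NNReal ENNReal

noncomputable section

section General

variable {G : Type*} [MeasurableSpace G]

/-- The superlevel set `G(t) = {x | t < ϖ x}` of the unnormalised density `ϖ`. -/
def slice (ϖ : G → ℝ) (t : ℝ) : Set G := {x | t < ϖ x}

/-- The normalised restriction `ν_t = ν(· ∩ G(t)) / ν(G(t))` of the reference measure `ν`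
to the slice `G(t)`. -/
def sliceMeasure (ν : Measure G) (ϖ : G → ℝ) (t : ℝ) : Measure G := ν[|slice ϖ t]

lemma sliceMeasure_apply (ν : Measure G) {ϖ : G → ℝ} (hϖ : Measurable ϖ) (t : ℝ) (A : Set G) :
    sliceMeasure ν ϖ t A = ν (A ∩ slice ϖ t) / ν (slice ϖ t) := by
  have hs : MeasurableSet (slice ϖ t) := measurableSet_lt measurable_const hϖ
  rw [sliceMeasure, cond_apply hs, Set.inter_comm, ENNReal.div_eq_inv_mul]

lemma measurable_sliceMeasure (ν : Measure G) {ϖ : G → ℝ} (hϖ : Measurable ϖ) :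
    Measurable (sliceMeasure ν ϖ) := by
  refine Measure.measurable_of_measurable_coe _ fun A _ => ?_
  simp only [sliceMeasure_apply ν hϖ]
  have h : ∀ B : Set G, Measurable fun t => ν (B ∩ slice ϖ t) := fun B =>
    Antitone.measurable fun s t hst => measure_mono
      (Set.inter_subset_inter_right B fun _ hx => lt_of_le_of_lt hst hx)
  have h' := h Set.univ
  simp only [Set.univ_inter] at h'
  exact (h A).div h'

lemma measurable_restrict_Ioo :
    Measurable fun s : ℝ => (volume : Measure ℝ).restrict (Set.Ioo 0 s) := by
  refine Measure.measurable_of_measurable_coe _ fun A _ => ?_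
  exact Monotone.measurable fun s t hst =>
    Measure.restrict_mono (Set.Ioo_subset_Ioo_right hst) le_rfl A

/-- The transition kernel of ideal slice sampling with reference measure `ν` and unnormalised
(positive) density `ϖ`: from `x`, draw `t` uniformly from `(0, ϖ x)`, then draw from `ν_t`. -/
def idealSlice (ν : Measure G) (ϖ : G → ℝ) (hϖ : Measurable ϖ) : Kernel G G where
  toFun x := (ENNReal.ofReal (ϖ x))⁻¹ •
    (volume.restrict (Set.Ioo 0 (ϖ x))).bind (sliceMeasure ν ϖ)
  measurable' := by
    refine Measure.measurable_of_measurable_coe _ fun A hA => ?_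
    simp only [Measure.smul_apply, smul_eq_mul]
    refine hϖ.ennreal_ofReal.inv.mul ?_
    exact (Measure.measurable_coe hA).comp
      ((Measure.measurable_bind' (measurable_sliceMeasure ν hϖ)).comp
        (measurable_restrict_Ioo.comp hϖ))

/-- The defining formula `U(x, A) = ϖ(x)⁻¹ ∫₀^{ϖ(x)} ν(A ∩ G(t)) / ν(G(t)) dt`. -/
lemma idealSlice_apply (ν : Measure G) (ϖ : G → ℝ) (hϖ : Measurable ϖ) (x : G)
    {A : Set G} (hA : MeasurableSet A) :
    idealSlice ν ϖ hϖ x A = (ENNReal.ofReal (ϖ x))⁻¹ *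
      ∫⁻ t in Set.Ioo 0 (ϖ x), ν (A ∩ slice ϖ t) / ν (slice ϖ t) := by
  change ((ENNReal.ofReal (ϖ x))⁻¹ •
    (volume.restrict (Set.Ioo 0 (ϖ x))).bind (sliceMeasure ν ϖ)) A = _
  rw [Measure.smul_apply, smul_eq_mul,
    Measure.bind_apply hA (measurable_sliceMeasure ν hϖ).aemeasurable]
  simp only [sliceMeasure_apply ν hϖ]

/-- The Dirichlet form `⟨(Id - P) f, f⟩_μ`, where `(P f)(x) = ∫ f(y) P(x, dy)`. -/
def dirichletForm (μ : Measure G) (P : Kernel G G) (f : G → ℝ) : ℝ :=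
  ∫ x, (f x - ∫ y, f y ∂(P x)) * f x ∂μ

/-- The infimum of the Dirichlet form of `P` over all `f ∈ L²(μ)` with `μ(f) = 0` and
`‖f‖_μ = 1`. A positive lower bound on this real number `sInf` can only hold if the set of
values is non-empty and bounded below, so it bounds every one of these values. -/
def infDirichletForm (μ : Measure G) (P : Kernel G G) : ℝ :=
  sInf {e : ℝ | ∃ f : G → ℝ, MemLp f 2 μ ∧ ∫ x, f x ∂μ = 0 ∧ ∫ x, f x ^ 2 ∂μ = 1 ∧
    e = dirichletForm μ P f}

end General

/-- The exponential distribution with rate `r`, as a measure on `[0, ∞)`. -/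
def expDist (r : ℝ) : Measure ℝ≥0 := (expMeasure r).comap ((↑) : ℝ≥0 → ℝ)

/-- The unnormalised density `ϖ(x) = exp (-(α - lam) x)` of `Exp(α)` relative to `Exp(lam)`. -/
def expRatio (α lam : ℝ) (x : ℝ≥0) : ℝ := Real.exp (-(α - lam) * x)

lemma measurable_expRatio (α lam : ℝ) : Measurable (expRatio α lam) := by
  unfold expRatio
  fun_prop

/-- The ideal slice sampler for the target `Exp(α)` with reference measure `Exp(lam)`. -/
def expSlice (α lam : ℝ) : Kernel ℝ≥0 ℝ≥0 :=
  idealSlice (expDist lam) (expRatio α lam) (measurable_expRatio α lam)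

end

/-! ### Averages along a kernel: contraction of L², reduction to bounded continuous functions,
factored kernels -/

section Kernels

variable {X T : Type*} [MeasurableSpace X] [MeasurableSpace T]

/-! The sampler factors as U = κ ∘ K, where K draws the level t given x and κ draws a point from the
slice at level t. Let τ be the law of the level under π. By Tonelli on the region under the graph of
ϖ, `π ⊗ₘ K` and `τ ⊗ₘ κ` are the same joint law up to swapping coordinates. Hence ⟨Uf, f⟩_π =
‖κf‖²_τ, and the Dirichlet form equals ‖f‖²_π − ‖κf‖²_τ. It remains to show ‖κg‖²_τ ≤ ρ‖g‖²_π for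
centred g, with 1 − ρ the asserted bound. Since κ contracts L², bounded continuous g suffice
(`le_dirichletForm_idealSlice`).

The slices are intervals, so κg is, after a change of variable, a running average m of g, tied to g
by a first-order linear differential equation.

For λ < α the nonempty slices are [0, r), and the estimate is a weighted Poincaré inequality for m
(`backward_average_le`) with extremal m = e^{-λr} − (α−λ)/(α+λ). For α < λ they are (r, ∞) and the
whole space, and the estimate is of Hardy type (`forward_average_le`): the critical growth e^{αr/2}
just fails to be square integrable against e^{-αr}.

Both inequalities are proved by exhibiting a function Q that vanishes at infinity and satisfies Q' ≤
D, by completion of a square. Here D is the difference of the two integrands plus correction terms.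
One of these is a multiple of g times its weight, which integrates to zero; this is where centring
enters.

For α = λ every slice is everything or empty, so averages of centred functions vanish and ρ = 0. -/

lemma eLpNorm_two_sq {μ : Measure X} (f : X → ℝ) :
    eLpNorm f 2 μ ^ 2 = ∫⁻ x, ‖f x‖ₑ ^ 2 ∂μ := by
  rw [eLpNorm_eq_lintegral_rpow_enorm_toReal two_ne_zero ENNReal.ofNat_ne_top,
    ← ENNReal.rpow_natCast, ← ENNReal.rpow_mul]
  simp

lemma eLpNorm_two_sq_eq_ofReal {μ : Measure X} {f : X → ℝ} (hf : MemLp f 2 μ) :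
    eLpNorm f 2 μ ^ 2 = ENNReal.ofReal (∫ x, f x ^ 2 ∂μ) := by
  rw [eLpNorm_two_sq, ofReal_integral_eq_lintegral_ofReal hf.integrable_sq
    (ae_of_all _ fun x => sq_nonneg _)]
  refine lintegral_congr fun x => ?_
  rw [← sq_abs, ENNReal.ofReal_pow (abs_nonneg _), Real.enorm_eq_ofReal_abs]

lemma ae_ae_of_ae_bind {τ : Measure T} {κ : Kernel T X} {p : X → Prop}
    (h : ∀ᵐ x ∂(τ.bind κ), p x) : ∀ᵐ t ∂τ, ∀ᵐ x ∂(κ t), p x := by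
  exact Measure.ae_ae_of_ae_comp h

lemma aestronglyMeasurable_integral_bind {τ : Measure T} {κ : Kernel T X} [IsSFiniteKernel κ]
    {f : X → ℝ} (hf : AEStronglyMeasurable f (τ.bind κ)) :
    AEStronglyMeasurable (fun t => ∫ x, f x ∂(κ t)) τ := by
  obtain ⟨g, hg, hfg⟩ := hf
  refine ⟨fun t => ∫ x, g x ∂(κ t), hg.integral_kernel, ?_⟩
  filter_upwards [ae_ae_of_ae_bind hfg] with t ht using integral_congr_ae ht

/-- Conditional averaging is a contraction of `L²`. -/
lemma eLpNorm_integral_bind_le {τ : Measure T} {κ : Kernel T X}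
    (hκ : ∀ t, κ t Set.univ ≤ 1) {f : X → ℝ} (hf : AEStronglyMeasurable f (τ.bind κ)) :
    eLpNorm (fun t => ∫ x, f x ∂(κ t)) 2 τ ≤ eLpNorm f 2 (τ.bind κ) := by
  rw [← ENNReal.pow_le_pow_left_iff two_ne_zero, eLpNorm_two_sq, eLpNorm_two_sq,
    Measure.lintegral_bind κ.aemeasurable (by fun_prop)]
  obtain ⟨g, hg, hfg⟩ := hf
  refine lintegral_mono_ae ?_
  filter_upwards [ae_ae_of_ae_bind hfg] with t ht
  have hm : AEStronglyMeasurable f (κ t) := ⟨g, hg, ht⟩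
  rw [← eLpNorm_two_sq]
  gcongr
  calc ‖∫ x, f x ∂(κ t)‖ₑ ≤ ∫⁻ x, ‖f x‖ₑ ∂(κ t) := enorm_integral_le_lintegral_enorm _
    _ = eLpNorm f 1 (κ t) := eLpNorm_one_eq_lintegral_enorm.symm
    _ ≤ eLpNorm f 2 (κ t) * κ t Set.univ ^ (1 / (1 : ℝ≥0∞).toReal - 1 / (2 : ℝ≥0∞).toReal) :=
      eLpNorm_le_eLpNorm_mul_rpow_measure_univ (by norm_num) hm
    _ ≤ eLpNorm f 2 (κ t) * 1 := by
      gcongr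
      exact ENNReal.rpow_le_one (hκ t) (by norm_num)
    _ = _ := mul_one _

/-- An `L²` bound for conditional averages of bounded continuous centred functions extends to all
centred functions in `L²`. -/
lemma eLpNorm_integral_bind_le_of_boundedContinuous [TopologicalSpace X] [NormalSpace X]
    [BorelSpace X]
    {π : Measure X} [IsProbabilityMeasure π] [π.WeaklyRegular] {τ : Measure T} {κ : Kernel T X}
    [IsSFiniteKernel κ]
    (hκ : ∀ t, κ t Set.univ ≤ 1) (hπ : τ.bind κ = π) {c : ℝ≥0}
    (h : ∀ g : X → ℝ, Continuous g → (∃ C, ∀ x, |g x| ≤ C) → ∫ x, g x ∂π = 0 →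
      eLpNorm (fun t => ∫ x, g x ∂(κ t)) 2 τ ≤ c * eLpNorm g 2 π)
    {f : X → ℝ} (hf : MemLp f 2 π) (hf0 : ∫ x, f x ∂π = 0) :
    eLpNorm (fun t => ∫ x, f x ∂(κ t)) 2 τ ≤ c * eLpNorm f 2 π := by
  have key : ∀ ε : ℝ≥0, 0 < ε →
      eLpNorm (fun t => ∫ x, f x ∂(κ t)) 2 τ ≤ c * eLpNorm f 2 π + (1 + c) * (2 * ε) := by
    intro ε hε
    obtain ⟨b, hb, hbm⟩ := hf.exists_boundedContinuous_eLpNorm_sub_le ENNReal.ofNat_ne_top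
      (ε := ε) (by simpa using hε.ne')
    have hfi : Integrable f π := hf.integrable (by norm_num)
    have hbi : Integrable b π := hbm.integrable (by norm_num)
    -- The approximant b need not be centred, but its mean is at most ε in absolute value because f
    -- is centred. Subtracting it at most doubles the error.
    set a := ∫ x, b x ∂π with ha
    let g : X → ℝ := fun x => b x - a
    have hgm : MemLp g 2 π := hbm.sub (memLp_const a)
    have hg0 : ∫ x, g x ∂π = 0 := by
      simp only [g]
      rw [integral_sub hbi (integrable_const _)]
      simp [ha]
    have ha' : ‖a‖ₑ ≤ ε := by
      have : a = - ∫ x, (f x - b x) ∂π := by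
        rw [integral_sub hfi hbi, hf0, ha]; ring
      rw [this, enorm_neg]
      calc _ ≤ ∫⁻ x, ‖f x - b x‖ₑ ∂π := enorm_integral_le_lintegral_enorm _
        _ = eLpNorm (f - ⇑b) 1 π := by rw [eLpNorm_one_eq_lintegral_enorm]; rfl
        _ ≤ eLpNorm (f - ⇑b) 2 π :=
          eLpNorm_le_eLpNorm_of_exponent_le (by norm_num) (hf.sub hbm).1
        _ ≤ ε := hb
    have hfg : eLpNorm (f - g) 2 π ≤ 2 * ε := by
      have : f - g = (f - ⇑b) + fun _ => a := by
        ext x; simp [g]; ring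
      rw [this, two_mul]
      refine (eLpNorm_add_le (hf.sub hbm).1 aestronglyMeasurable_const (by norm_num)).trans
        (add_le_add hb ?_)
      rw [eLpNorm_const a (by norm_num) (IsProbabilityMeasure.ne_zero π)]
      simpa using ha'
    have hgb := h g (b.continuous.sub continuous_const)
      ⟨‖b‖ + |a|, fun x => (abs_sub _ _).trans (add_le_add (b.norm_coe_le_norm x) le_rfl)⟩ hg0
    have hfgm := hf.sub hgm
    have hsplit : (fun t => ∫ x, f x ∂(κ t)) =ᵐ[τ]
        (fun t => ∫ x, (f - g) x ∂(κ t)) + fun t => ∫ x, g x ∂(κ t) := by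
      have h1 := hfi
      have h2 := hgm.integrable (by norm_num : (1 : ℝ≥0∞) ≤ 2)
      rw [← hπ] at h1 h2
      filter_upwards [Measure.ae_integrable_of_integrable_comp h1,
        Measure.ae_integrable_of_integrable_comp h2] with t ht1 ht2
      simp only [Pi.add_apply, Pi.sub_apply]
      rw [integral_sub ht1 ht2]; ring
    rw [eLpNorm_congr_ae hsplit]
    have hm1 : AEStronglyMeasurable (f - g) (τ.bind κ) := by rw [hπ]; exact hfgm.1
    have hm2 : AEStronglyMeasurable g (τ.bind κ) := by rw [hπ]; exact hgm.1
    have hgf : eLpNorm g 2 π ≤ eLpNorm f 2 π + 2 * ε := by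
      have : g = f - (f - g) := by ext x; simp
      rw [this]
      exact (eLpNorm_sub_le hf.1 hfgm.1 (by norm_num)).trans (add_le_add le_rfl hfg)
    have hcontr : eLpNorm (fun t => ∫ x, (f - g) x ∂(κ t)) 2 τ ≤ 2 * ε :=
      (eLpNorm_integral_bind_le hκ hm1).trans (by rwa [hπ])
    calc _ ≤ eLpNorm (fun t => ∫ x, (f - g) x ∂(κ t)) 2 τ + eLpNorm (fun t => ∫ x, g x ∂(κ t)) 2 τ :=
          eLpNorm_add_le (aestronglyMeasurable_integral_bind hm1)
            (aestronglyMeasurable_integral_bind hm2) (by norm_num)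
      _ ≤ 2 * ε + c * (eLpNorm f 2 π + 2 * ε) := by
          gcongr
          exact hgb.trans (by gcongr)
      _ = _ := by ring
  refine ENNReal.le_of_forall_pos_le_add fun ε hε _ => ?_
  refine (key (ε / (2 * (1 + c))) (by positivity)).trans (le_of_eq ?_)
  congr 1
  norm_cast
  field_simp

/-- If `π ⊗ K` and `τ ⊗ κ` are the same joint law, then `⟨(κ ∘ K) f, f⟩_π = ‖κ f‖²_τ`. -/
lemma integral_comp_mul_self {π : Measure X} [IsProbabilityMeasure π] {τ : Measure T} [SFinite τ]
    {K : Kernel X T} [IsMarkovKernel K] {κ : Kernel T X} [IsFiniteKernel κ]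
    (hκ : ∀ t, κ t Set.univ ≤ 1) (hJ : π ⊗ₘ K = (τ ⊗ₘ κ).map Prod.swap)
    (hπ : τ.bind κ = π) (hτ : π.bind K = τ) {f : X → ℝ} (hf : MemLp f 2 π) :
    Integrable (fun x => (∫ y, f y ∂((κ ∘ₖ K) x)) * f x) π ∧
    ∫ x, (∫ y, f y ∂((κ ∘ₖ K) x)) * f x ∂π = ∫ t, (∫ y, f y ∂(κ t)) ^ 2 ∂τ := by
  set m : T → ℝ := fun t => ∫ y, f y ∂(κ t) with hm
  have hfb : AEStronglyMeasurable f (τ.bind κ) := by rw [hπ]; exact hf.1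
  have hmL : MemLp m 2 τ := ⟨aestronglyMeasurable_integral_bind hfb,
    (eLpNorm_integral_bind_le hκ hfb).trans_lt (by rw [hπ]; exact hf.2)⟩
  have hfst : (π ⊗ₘ K).map Prod.fst = π := Measure.fst_compProd π K
  have hsnd : (π ⊗ₘ K).map Prod.snd = τ := (Measure.snd_compProd π K).trans hτ
  have h1 : MemLp (fun p : X × T => f p.1) 2 (π ⊗ₘ K) :=
    MemLp.comp_measurePreserving hf ⟨measurable_fst, hfst⟩
  have h2 : MemLp (fun p : X × T => m p.2) 2 (π ⊗ₘ K) :=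
    MemLp.comp_measurePreserving hmL ⟨measurable_snd, hsnd⟩
  -- Both sides are the integral of m(t) f(x) over the joint law. Disintegrating from x gives the
  -- left side, disintegrating from t gives ∫ m².
  have hint : Integrable (fun p : X × T => m p.2 * f p.1) (π ⊗ₘ K) := h2.integrable_mul h1
  have hU : ∀ᵐ x ∂π, ∫ y, f y ∂((κ ∘ₖ K) x) = ∫ t, m t ∂(K x) := by
    have hi : Integrable f (π.bind (κ ∘ₖ K)) := by
      rw [← Measure.comp_assoc, hτ, hπ]; exact hf.integrable (by norm_num)
    filter_upwards [Measure.ae_integrable_of_integrable_comp hi] with x hx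
    exact Kernel.integral_comp hx
  have hcongr : (fun x => (∫ y, f y ∂((κ ∘ₖ K) x)) * f x) =ᵐ[π]
      fun x => ∫ t, m t * f x ∂(K x) := by
    filter_upwards [hU] with x hx
    rw [hx, integral_mul_const]
  refine ⟨?_, ?_⟩
  · rw [integrable_congr hcongr]
    exact Integrable.integral_compProd hint
  · rw [integral_congr_ae hcongr, ← Measure.integral_compProd hint]
    have hint' := hint
    rw [hJ] at hint' ⊢
    rw [integral_map measurable_swap.aemeasurable hint'.1]
    rw [integrable_map_measure hint'.1 measurable_swap.aemeasurable] at hint'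
    change ∫ p, ((fun p : X × T => m p.2 * f p.1) ∘ Prod.swap) p ∂(τ ⊗ₘ κ) = _
    rw [Measure.integral_compProd hint']
    refine integral_congr_ae (ae_of_all _ fun t => ?_)
    simp only [Function.comp_apply, Prod.snd_swap, Prod.fst_swap]
    rw [integral_const_mul, sq]

end Kernels

/-! ### The ideal slice sampler as level kernel followed by slice kernel -/

section Slice

variable {X : Type*} [MeasurableSpace X]

/-- The kernel drawing the level `t` uniformly from `(0, ϖ x)`. -/
noncomputable def levelKernel (ϖ : X → ℝ) (hϖ : Measurable ϖ) : Kernel X ℝ where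
  toFun x := (ENNReal.ofReal (ϖ x))⁻¹ • volume.restrict (Set.Ioo 0 (ϖ x))
  measurable' := by
    refine Measure.measurable_of_measurable_coe _ fun A hA => ?_
    simp only [Measure.smul_apply, smul_eq_mul]
    exact hϖ.ennreal_ofReal.inv.mul
      ((Measure.measurable_coe hA).comp (measurable_restrict_Ioo.comp hϖ))

/-- The kernel drawing a point from the normalised slice at level `t`. -/
noncomputable def sliceKernel (ν : Measure X) (ϖ : X → ℝ) (hϖ : Measurable ϖ) : Kernel ℝ X where
  toFun := sliceMeasure ν ϖ
  measurable' := measurable_sliceMeasure ν hϖ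

/-- The marginal law of the level when the point is distributed as `z ϖ dν`. -/
noncomputable def levelMeasure (ν : Measure X) (ϖ : X → ℝ) (z : ℝ≥0∞) : Measure ℝ :=
  (volume.restrict (Set.Ioi 0)).withDensity fun t => z * ν (slice ϖ t)

variable {ν : Measure X} {ϖ : X → ℝ}

lemma measurable_measure_slice (ν : Measure X) (ϖ : X → ℝ) :
    Measurable fun t => ν (slice ϖ t) :=
  Antitone.measurable fun _ _ hst => measure_mono fun _ hx => lt_of_le_of_lt hst hx

lemma lintegral_levelMeasure (ν : Measure X) (ϖ : X → ℝ) (z : ℝ≥0∞) {g : ℝ → ℝ≥0∞}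
    (hg : Measurable g) :
    ∫⁻ t, g t ∂(levelMeasure ν ϖ z) = ∫⁻ t in Set.Ioi 0, z * ν (slice ϖ t) * g t :=
  lintegral_withDensity_eq_lintegral_mul _ ((measurable_measure_slice ν ϖ).const_mul z) hg

lemma idealSlice_eq_comp (hϖ : Measurable ϖ) :
    idealSlice ν ϖ hϖ = sliceKernel ν ϖ hϖ ∘ₖ levelKernel ϖ hϖ := by
  ext x A hA
  rw [Kernel.comp_apply]
  change ((ENNReal.ofReal (ϖ x))⁻¹ • (volume.restrict (Set.Ioo 0 (ϖ x))).bind _) A =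
    (((ENNReal.ofReal (ϖ x))⁻¹ • volume.restrict (Set.Ioo 0 (ϖ x))).bind (sliceMeasure ν ϖ)) A
  rw [Measure.smul_apply, Measure.bind_apply hA (measurable_sliceMeasure ν hϖ).aemeasurable,
    Measure.bind_apply hA (measurable_sliceMeasure ν hϖ).aemeasurable, lintegral_smul_measure]

/-- Only an inequality: on a null slice the conditional measure is zero, so the kernel is merely
sub-Markov. -/
lemma sliceKernel_univ_le (hϖ : Measurable ϖ) (t : ℝ) :
    sliceKernel ν ϖ hϖ t Set.univ ≤ 1 :=
  prob_le_one (μ := ν[|slice ϖ t])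

instance isFiniteKernel_sliceKernel (hϖ : Measurable ϖ) :
    IsFiniteKernel (sliceKernel ν ϖ hϖ) :=
  ⟨1, ENNReal.one_lt_top, sliceKernel_univ_le hϖ⟩

lemma isMarkovKernel_levelKernel (hϖ : Measurable ϖ) (hpos : ∀ x, 0 < ϖ x) :
    IsMarkovKernel (levelKernel ϖ hϖ) := by
  refine ⟨fun x => ⟨?_⟩⟩
  change ((ENNReal.ofReal (ϖ x))⁻¹ • volume.restrict (Set.Ioo 0 (ϖ x))) Set.univ = 1
  rw [Measure.smul_apply, Measure.restrict_apply_univ, Real.volume_Ioo, sub_zero, smul_eq_mul]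
  exact ENNReal.inv_mul_cancel (by simpa using hpos x) ENNReal.ofReal_ne_top

variable [IsProbabilityMeasure ν] {π : Measure X} {z : ℝ≥0∞}

/-- Both sides are z times the integral of h over {0 < t < ϖ x} against ν ⊗ Lebesgue: the
normalisation ϖ(x) of the level cancels the density of π, and ν(slice) cancels the density of the
level law. Stationarity, the level marginal and equality of the joint laws all follow by choosing h.
-/
lemma lintegral_levelKernel_eq (hϖ : Measurable ϖ) (hpos : ∀ x, 0 < ϖ x)
    (hπ : π = z • ν.withDensity fun x => ENNReal.ofReal (ϖ x)) {h : X × ℝ → ℝ≥0∞}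
    (hh : Measurable h) :
    ∫⁻ x, ∫⁻ t, h (x, t) ∂(levelKernel ϖ hϖ x) ∂π =
      ∫⁻ t, ∫⁻ x, h (x, t) ∂(sliceKernel ν ϖ hϖ t) ∂(levelMeasure ν ϖ z) := by
  have := isMarkovKernel_levelKernel hϖ hpos
  have hsl : ∀ t, MeasurableSet (slice ϖ t) := fun t => measurableSet_lt measurable_const hϖ
  have hset : MeasurableSet {p : X × ℝ | p.2 < ϖ p.1} :=
    measurableSet_lt measurable_snd (hϖ.comp measurable_fst)
  have hm : Measurable ({p : X × ℝ | p.2 < ϖ p.1}.indicator h) := hh.indicator hset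
  have hL : ∀ x, ENNReal.ofReal (ϖ x) * ∫⁻ t, h (x, t) ∂(levelKernel ϖ hϖ x) =
      ∫⁻ t in Set.Ioi 0, {p : X × ℝ | p.2 < ϖ p.1}.indicator h (x, t) := by
    intro x
    change _ * ∫⁻ t, h (x, t) ∂((ENNReal.ofReal (ϖ x))⁻¹ • volume.restrict (Set.Ioo 0 (ϖ x))) = _
    rw [lintegral_smul_measure, smul_eq_mul, ← mul_assoc,
      ENNReal.mul_inv_cancel (by simpa using hpos x) ENNReal.ofReal_ne_top, one_mul]
    have : Set.Ioo 0 (ϖ x) = Set.Iio (ϖ x) ∩ Set.Ioi 0 := by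
      ext t; simp [and_comm]
    rw [this, ← Measure.restrict_restrict measurableSet_Iio, ← lintegral_indicator measurableSet_Iio]
    rfl
  have hR : ∀ t, z * ν (slice ϖ t) * ∫⁻ x, h (x, t) ∂(sliceKernel ν ϖ hϖ t) =
      z * ∫⁻ x, {p : X × ℝ | p.2 < ϖ p.1}.indicator h (x, t) ∂ν := by
    intro t
    have : ∫⁻ x, {p : X × ℝ | p.2 < ϖ p.1}.indicator h (x, t) ∂ν =
        ∫⁻ x in slice ϖ t, h (x, t) ∂ν := by
      rw [← lintegral_indicator (hsl t)]; rfl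
    rw [this, mul_assoc]
    congr 1
    change _ * ∫⁻ x, h (x, t) ∂((ν (slice ϖ t))⁻¹ • ν.restrict (slice ϖ t)) = _
    rw [lintegral_smul_measure, smul_eq_mul, ← mul_assoc]
    rcases eq_or_ne (ν (slice ϖ t)) 0 with h0 | h0
    · rw [Measure.restrict_eq_zero.2 h0]; simp
    · rw [ENNReal.mul_inv_cancel h0 (measure_ne_top _ _), one_mul]
  have hk1 : Measurable fun x => ∫⁻ t, h (x, t) ∂(levelKernel ϖ hϖ x) :=
    hh.lintegral_kernel_prod_right'
  have hk2 : Measurable fun t => ∫⁻ x, h (x, t) ∂(sliceKernel ν ϖ hϖ t) :=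
    (hh.comp measurable_swap).lintegral_kernel_prod_right'
  rw [hπ, lintegral_smul_measure, lintegral_withDensity_eq_lintegral_mul _ hϖ.ennreal_ofReal hk1,
    lintegral_levelMeasure _ _ _ hk2]
  simp only [Pi.mul_apply, hL, hR]
  rw [lintegral_const_mul z (f := fun t => ∫⁻ x, {p : X × ℝ | p.2 < ϖ p.1}.indicator h (x, t) ∂ν)
      (hm.comp measurable_swap).lintegral_prod_right', smul_eq_mul,
    lintegral_lintegral_swap
      (f := fun x t => {p : X × ℝ | p.2 < ϖ p.1}.indicator h (x, t)) hm.aemeasurable]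

lemma levelMeasure_bind_sliceKernel (hϖ : Measurable ϖ) (hpos : ∀ x, 0 < ϖ x)
    (hπ : π = z • ν.withDensity fun x => ENNReal.ofReal (ϖ x)) :
    (levelMeasure ν ϖ z).bind (sliceKernel ν ϖ hϖ) = π := by
  have := isMarkovKernel_levelKernel hϖ hpos
  ext A hA
  rw [Measure.bind_apply hA (Kernel.aemeasurable _)]
  have := lintegral_levelKernel_eq hϖ hpos hπ (h := fun p => A.indicator 1 p.1)
    ((measurable_one.indicator hA).comp measurable_fst)
  simp only [lintegral_indicator_one hA] at this
  rw [← this]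
  simp [lintegral_indicator_one hA]

lemma bind_levelKernel (hϖ : Measurable ϖ) (hpos : ∀ x, 0 < ϖ x)
    (hπ : π = z • ν.withDensity fun x => ENNReal.ofReal (ϖ x)) :
    π.bind (levelKernel ϖ hϖ) = levelMeasure ν ϖ z := by
  ext A hA
  rw [Measure.bind_apply hA (Kernel.aemeasurable _)]
  have := lintegral_levelKernel_eq hϖ hpos hπ (h := fun p => A.indicator 1 p.2)
    ((measurable_one.indicator hA).comp measurable_snd)
  simp only [lintegral_indicator_one hA, lintegral_const] at this
  have hmeas : Measurable fun t => A.indicator 1 t * sliceKernel ν ϖ hϖ t Set.univ :=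
    (measurable_one.indicator hA).mul ((sliceKernel ν ϖ hϖ).measurable_coe MeasurableSet.univ)
  rw [this, lintegral_levelMeasure _ _ _ hmeas, levelMeasure,
    withDensity_apply _ hA, ← lintegral_indicator hA]
  refine lintegral_congr fun t => ?_
  by_cases ht : t ∈ A
  · simp only [Set.indicator_of_mem ht, Pi.one_apply, one_mul]
    change _ * ((ν (slice ϖ t))⁻¹ • ν.restrict (slice ϖ t)) Set.univ = _
    rw [Measure.smul_apply, Measure.restrict_apply_univ, smul_eq_mul, mul_assoc]
    rcases eq_or_ne (ν (slice ϖ t)) 0 with h0 | h0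
    · simp [h0]
    · rw [ENNReal.inv_mul_cancel h0 (measure_ne_top _ _), mul_one]
  · simp [ht]

variable [IsProbabilityMeasure π]

lemma compProd_levelKernel (hϖ : Measurable ϖ) (hpos : ∀ x, 0 < ϖ x) [SFinite (levelMeasure ν ϖ z)]
    (hπ : π = z • ν.withDensity fun x => ENNReal.ofReal (ϖ x)) :
    π ⊗ₘ levelKernel ϖ hϖ = (levelMeasure ν ϖ z ⊗ₘ sliceKernel ν ϖ hϖ).map Prod.swap := by
  have := isMarkovKernel_levelKernel hϖ hpos
  refine Measure.ext_of_lintegral _ fun h hh => ?_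
  rw [Measure.lintegral_compProd hh, lintegral_map hh measurable_swap,
    Measure.lintegral_compProd (f := fun p => h p.swap) (hh.comp measurable_swap)]
  exact lintegral_levelKernel_eq hϖ hpos hπ hh

/-- A contraction estimate for slice averages of bounded continuous centred functions bounds the
Dirichlet form of the ideal slice sampler from below. -/
lemma le_dirichletForm_idealSlice [TopologicalSpace X] [NormalSpace X] [BorelSpace X]
    [π.WeaklyRegular] (hϖ : Measurable ϖ) (hpos : ∀ x, 0 < ϖ x)
    (hπ : π = z • ν.withDensity fun x => ENNReal.ofReal (ϖ x)) {ρ : ℝ} (hρ : 0 ≤ ρ)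
    (h : ∀ g : X → ℝ, Continuous g → (∃ C, ∀ x, |g x| ≤ C) → ∫ x, g x ∂π = 0 →
      ∫ t, (∫ x, g x ∂(sliceMeasure ν ϖ t)) ^ 2 ∂(levelMeasure ν ϖ z) ≤ ρ * ∫ x, g x ^ 2 ∂π)
    {f : X → ℝ} (hf : MemLp f 2 π) (hf0 : ∫ x, f x ∂π = 0) :
    (1 - ρ) * ∫ x, f x ^ 2 ∂π ≤ dirichletForm π (idealSlice ν ϖ hϖ) f := by
  have hK := isMarkovKernel_levelKernel hϖ hpos
  have hτ := bind_levelKernel hϖ hpos hπ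
  have hτp : IsProbabilityMeasure (levelMeasure ν ϖ z) := by rw [← hτ]; infer_instance
  have hκ := sliceKernel_univ_le (ν := ν) hϖ
  have hb := levelMeasure_bind_sliceKernel hϖ hpos hπ
  have hmem : ∀ g : X → ℝ, MemLp g 2 π →
      MemLp (fun t => ∫ x, g x ∂(sliceKernel ν ϖ hϖ t)) 2 (levelMeasure ν ϖ z) := by
    intro g hg
    have hm : AEStronglyMeasurable g ((levelMeasure ν ϖ z).bind (sliceKernel ν ϖ hϖ)) := by
      rw [hb]; exact hg.1
    exact ⟨aestronglyMeasurable_integral_bind hm,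
      (eLpNorm_integral_bind_le hκ hm).trans_lt (by rw [hb]; exact hg.2)⟩
  have hc : ENNReal.ofReal ρ = ((Real.toNNReal (√ρ) : ℝ≥0) : ℝ≥0∞) ^ 2 := by
    rw [← ENNReal.ofReal, ← ENNReal.ofReal_pow (Real.sqrt_nonneg _), Real.sq_sqrt hρ]
  -- The density argument uses extended norms with constant √ρ, the analytic estimates use real
  -- integrals of squares with constant ρ.
  have hiff : ∀ g : X → ℝ, MemLp g 2 π →
      (eLpNorm (fun t => ∫ x, g x ∂(sliceKernel ν ϖ hϖ t)) 2 (levelMeasure ν ϖ z) ≤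
        (Real.toNNReal (√ρ) : ℝ≥0) * eLpNorm g 2 π ↔
      ∫ t, (∫ x, g x ∂(sliceMeasure ν ϖ t)) ^ 2 ∂(levelMeasure ν ϖ z) ≤ ρ * ∫ x, g x ^ 2 ∂π) := by
    intro g hg
    rw [← ENNReal.pow_le_pow_left_iff two_ne_zero, mul_pow, ← hc,
      eLpNorm_two_sq_eq_ofReal hg, eLpNorm_two_sq_eq_ofReal (hmem g hg),
      ← ENNReal.ofReal_mul hρ, ENNReal.ofReal_le_ofReal_iff]
    · rfl
    · exact mul_nonneg hρ (integral_nonneg fun x => sq_nonneg _)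
  have hmain := (hiff f hf).1 (eLpNorm_integral_bind_le_of_boundedContinuous hκ hb
    (fun g hg hgb hg0 => (hiff g (by
      obtain ⟨C, hC⟩ := hgb
      exact MemLp.of_bound hg.measurable.aestronglyMeasurable C (ae_of_all _ hC))).2
        (h g hg hgb hg0)) hf hf0)
  obtain ⟨hi, he⟩ := integral_comp_mul_self hκ (compProd_levelKernel hϖ hpos hπ) hb hτ hf
  rw [← idealSlice_eq_comp] at hi he
  have hD : dirichletForm π (idealSlice ν ϖ hϖ) f = ∫ x, f x ^ 2 ∂π -
      ∫ t, (∫ x, f x ∂(sliceMeasure ν ϖ t)) ^ 2 ∂(levelMeasure ν ϖ z) := by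
    rw [show (∫ t, (∫ x, f x ∂(sliceMeasure ν ϖ t)) ^ 2 ∂(levelMeasure ν ϖ z)) = _ from he.symm,
      ← integral_sub hf.integrable_sq hi, dirichletForm]
    refine integral_congr_ae (ae_of_all _ fun x => ?_)
    ring
  rw [hD]
  linarith

end Slice

/-! ### Hardy-type inequality for averages over (r, ∞) -/

section Hardy

open Filter Topology Set

lemma integrableOn_mul_exp_neg {f : ℝ → ℝ} {a B : ℝ} (ha : 0 < a) (hf : ContinuousOn f (Ioi 0))
    (hB : ∀ x, 0 < x → |f x| ≤ B) : IntegrableOn (fun x => f x * Real.exp (-a * x)) (Ioi 0) := by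
  refine Integrable.bdd_mul (integrableOn_exp_mul_Ioi (by linarith) 0)
    (hf.aestronglyMeasurable measurableSet_Ioi) (c := B) ?_
  exact (ae_restrict_iff' measurableSet_Ioi).2 (ae_of_all _ fun x hx => hB x hx)

lemma tendsto_exp_neg_mul_atTop {a : ℝ} (ha : 0 < a) :
    Tendsto (fun x => Real.exp (-a * x)) atTop (𝓝 0) :=
  Real.tendsto_exp_atBot.comp (tendsto_id.const_mul_atTop_of_neg (by linarith))

lemma hasDerivAt_exp_neg_mul (a x : ℝ) :
    HasDerivAt (fun x => Real.exp (-a * x)) (-a * Real.exp (-a * x)) x := by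
  have := ((hasDerivAt_id x).const_mul (-a)).exp
  simpa [mul_comm] using this

/-- The Hardy-type inequality for forward averages `m' = (α + k) (m - g)`. -/
lemma forward_average_le {α k B : ℝ} (hα0 : 0 < α) (hk : 0 < k) {g m : ℝ → ℝ}
    (hg : Continuous g) (hgB : ∀ r, |g r| ≤ B) (hm : ∀ r, HasDerivAt m ((α + k) * (m r - g r)) r)
    (hmB : ∀ r, 0 ≤ r → |m r| ≤ B)
    (hg0 : ∫ r in Ioi 0, g r * Real.exp (-α * r) = 0) :
    (α + k + k) ^ 2 / 4 * (m 0 ^ 2 / k + ∫ r in Ioi 0, m r ^ 2 * Real.exp (-α * r)) ≤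
      (α + k) ^ 2 * ∫ r in Ioi 0, g r ^ 2 * Real.exp (-α * r) := by
  set p : ℝ → ℝ := fun r => Real.exp (-α * r) with hp
  have hmc : Continuous m := continuous_iff_continuousAt.2 fun r => (hm r).continuousAt
  have hB0 : 0 ≤ B := (abs_nonneg _).trans (hgB 0)
  -- Q and D are chosen so that D − Q' = (m' − (α/2)(m − m 0))² p. The factor α/2 is the critical
  -- exponent, and the shift by m 0 is compensated by the terms linear in m and g.
  set Q : ℝ → ℝ := fun r => (α / 2 * (m r - m 0) ^ 2 - (α + k) * m r ^ 2
    - α ^ 2 * m 0 / (2 * k) * m r) * p r with hQ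
  set D : ℝ → ℝ := fun r => (α + k) ^ 2 * (g r ^ 2 * p r)
    - (α + k + k) ^ 2 / 4 * (m r ^ 2 * p r)
    + α ^ 2 * m 0 * (α + k) / (2 * k) * (g r * p r) - α ^ 2 / 4 * m 0 ^ 2 * p r with hD
  have hsq : ∀ x, |x| ≤ B → |x ^ 2| ≤ B ^ 2 := fun x hx => by
    rw [abs_pow]; gcongr
  have i1 : IntegrableOn (fun r => g r ^ 2 * p r) (Ioi 0) :=
    integrableOn_mul_exp_neg hα0 (hg.pow 2).continuousOn fun x _ => hsq _ (hgB x)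
  have i2 : IntegrableOn (fun r => m r ^ 2 * p r) (Ioi 0) :=
    integrableOn_mul_exp_neg hα0 (hmc.pow 2).continuousOn fun x hx => hsq _ (hmB x hx.le)
  have i3 : IntegrableOn (fun r => g r * p r) (Ioi 0) :=
    integrableOn_mul_exp_neg hα0 hg.continuousOn fun x _ => hgB x
  have i4 : IntegrableOn p (Ioi 0) := integrableOn_exp_mul_Ioi (by linarith) 0
  have j1 := i1.const_mul ((α + k) ^ 2)
  have j2 := i2.const_mul ((α + k + k) ^ 2 / 4)
  have j3 := i3.const_mul (α ^ 2 * m 0 * (α + k) / (2 * k))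
  have j4 := i4.const_mul (α ^ 2 / 4 * m 0 ^ 2)
  have iD : IntegrableOn D (Ioi 0) := ((j1.sub j2).add j3).sub j4
  have hp0 : ∫ r in Ioi 0, p r = 1 / α := by
    rw [hp, integral_exp_mul_Ioi (by linarith)]; simp
  have hDint : ∫ r in Ioi 0, D r = (α + k) ^ 2 * (∫ r in Ioi 0, g r ^ 2 * p r)
      - (α + k + k) ^ 2 / 4 * (∫ r in Ioi 0, m r ^ 2 * p r) - α / 4 * m 0 ^ 2 := by
    refine (integral_sub ((j1.sub j2).add j3) j4).trans ?_
    rw [integral_add' (j1.sub j2) j3, integral_sub' j1 j2,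
      integral_const_mul, integral_const_mul, integral_const_mul, integral_const_mul, hg0, hp0]
    field_simp
    ring
  have hQd : ∀ r, HasDerivAt Q (D r - ((α + k) * (m r - g r) - α / 2 * (m r - m 0)) ^ 2 * p r) r := by
    intro r
    have h1 := (((((hm r).sub_const (m 0)).pow 2).const_mul (α / 2)).sub
      (((hm r).pow 2).const_mul (α + k))).sub ((hm r).const_mul (α ^ 2 * m 0 / (2 * k)))
    refine (h1.mul (hasDerivAt_exp_neg_mul α r)).congr_deriv ?_
    simp only [hD, hp, Pi.pow_apply, Pi.sub_apply]
    field_simp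
    ring
  have hle : ∀ R, 0 ≤ R → Q R - Q 0 ≤ ∫ r in (0:ℝ)..R, D r := fun R hR => by
    refine intervalIntegral.sub_le_integral_of_hasDeriv_right_of_le hR
      (fun r _ => (hQd r).continuousAt.continuousWithinAt)
      (fun r _ => (hQd r).hasDerivWithinAt) ?_ fun r _ => ?_
    · exact (by fun_prop : Continuous D).integrableOn_Icc
    · have : 0 ≤ ((α + k) * (m r - g r) - α / 2 * (m r - m 0)) ^ 2 * p r := by positivity
      linarith
  have hQt : Tendsto Q atTop (𝓝 0) := by
    refine bdd_le_mul_tendsto_zero' (α / 2 * (2 * B) ^ 2 + (α + k) * B ^ 2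
      + |α ^ 2 * m 0 / (2 * k)| * B) ?_ (tendsto_exp_neg_mul_atTop hα0)
    filter_upwards [eventually_ge_atTop 0] with r hr
    refine (abs_sub _ _).trans (add_le_add ((abs_sub _ _).trans (add_le_add ?_ ?_)) ?_)
    · rw [abs_mul, abs_of_pos (by positivity : 0 < α / 2), abs_pow]
      have : |m r - m 0| ≤ 2 * B := by
        have := (abs_sub (m r) (m 0)); linarith [hmB r hr, hmB 0 le_rfl]
      gcongr
    · rw [abs_mul, abs_of_pos (by positivity : 0 < α + k)]
      gcongr; exact hsq _ (hmB r hr)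
    · rw [abs_mul]; gcongr; exact hmB r hr
  have hlim := le_of_tendsto_of_tendsto (hQt.sub_const (Q 0))
    (intervalIntegral_tendsto_integral_Ioi 0 iD tendsto_id)
    ((eventually_ge_atTop 0).mono fun R hR => hle R hR)
  rw [hDint] at hlim
  have hQ0 : Q 0 = -((α + k) * m 0 ^ 2) - α ^ 2 * m 0 ^ 2 / (2 * k) := by
    simp only [hQ, hp]; simp; ring
  rw [hQ0] at hlim
  -- The boundary term at 0 more than pays for the m(0)² term of the claim; the surplus is m(0)²
  -- (α/4 + α²/(4k)).
  have hfin : (α + k + k) ^ 2 / 4 * (m 0 ^ 2 / k) ≤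
      α / 4 * m 0 ^ 2 + (α + k) * m 0 ^ 2 + α ^ 2 * m 0 ^ 2 / (2 * k) := by
    have : α / 4 * m 0 ^ 2 + (α + k) * m 0 ^ 2 + α ^ 2 * m 0 ^ 2 / (2 * k)
      - (α + k + k) ^ 2 / 4 * (m 0 ^ 2 / k) = m 0 ^ 2 * (α / 4 + α ^ 2 / (4 * k)) := by
      field_simp; ring
    have : 0 ≤ m 0 ^ 2 * (α / 4 + α ^ 2 / (4 * k)) := by positivity
    linarith
  linarith

end Hardy

/-! ### Poincaré-type inequality for averages over [0, r) -/

section Poincare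

open Filter Topology Set

/-- `h² / φ` is continuous at a common zero of `h` and `φ` at which `φ' ≠ 0`. -/
lemma continuousAt_sq_div {h φ : ℝ → ℝ} {a h' φ' : ℝ} (hh : HasDerivAt h h' a) (h0 : h a = 0)
    (hφ : HasDerivAt φ φ' a) (φ0 : φ a = 0) (hφ' : φ' ≠ 0) :
    ContinuousAt (fun r => h r ^ 2 / φ r) a := by
  have h1 : ContinuousAt (dslope h a) a := continuousAt_dslope_same.2 hh.differentiableAt
  have h2 : ContinuousAt (dslope φ a) a := continuousAt_dslope_same.2 hφ.differentiableAt
  have h3 : dslope φ a a ≠ 0 := by rwa [dslope_same, hφ.deriv]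
  have h4 : ContinuousAt (fun r => (r - a) * dslope h a r ^ 2 / dslope φ a r) a :=
    ((by fun_prop : ContinuousAt (fun r => r - a) a).mul (h1.pow 2)).div h2 h3
  refine h4.congr ?_
  refine Eventually.of_forall fun r => ?_
  have e1 := sub_smul_dslope h a r
  have e2 := sub_smul_dslope φ a r
  rw [h0, sub_zero, smul_eq_mul] at e1
  rw [φ0, sub_zero, smul_eq_mul] at e2
  change (r - a) * dslope h a r ^ 2 / dslope φ a r = _
  rcases eq_or_ne r a with rfl | hr
  · simp [h0]
  · change _ = h r ^ 2 / φ r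
    rw [← e1, ← e2]
    have := sub_ne_zero.2 hr
    rcases eq_or_ne (dslope φ a r) 0 with h5 | h5
    · simp [h5]
    · field_simp

/-- The Poincaré-type inequality for backward averages
`m r = (∫₀ʳ g y l e^{-l y} dy) / (1 - e^{-l r})`. -/
lemma backward_average_le {l d B : ℝ} (hl : 0 < l) (hd : 0 < d) {g m : ℝ → ℝ}
    (hg : Continuous g) (hgB : ∀ r, |g r| ≤ B)
    (hm : ∀ r, 0 < r → HasDerivAt m
      (l * Real.exp (-l * r) * (g r - m r) / (1 - Real.exp (-l * r))) r)
    (hmB : ∀ r, 0 < r → |m r| ≤ B)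
    (hg0 : ∫ r in Ioi 0, g r * Real.exp (-(d + l) * r) = 0) :
    2 * (d + l) / l * ∫ r in Ioi 0, m r ^ 2 * (Real.exp (-d * r) * (1 - Real.exp (-l * r))) ≤
      ∫ r in Ioi 0, g r ^ 2 * Real.exp (-(d + l) * r) := by
  set k := d + 2 * l with hk
  have hk0 : 0 < k := by positivity
  -- Behind the claim lies (k/l) ∫ (m − c)² v ≤ ∫ P m'², with v = e^{-dr}(1 − e^{-lr}) and P = v (1
  -- − e^{-lr}) / (l² e^{-lr}). The function φ solves the Sturm–Liouville equation (Pφ')' + (k/l) v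
  -- φ = 0 and has r₀ as its only zero.
  set φ : ℝ → ℝ := fun r => Real.exp (-l * r) - d / k with hφ
  set r₀ := -Real.log (d / k) / l with hr₀
  have hdk : d / k < 1 := by rw [div_lt_one hk0]; linarith
  have hdk0 : 0 < d / k := by positivity
  have hr₀p : 0 < r₀ := div_pos (neg_pos.2 (Real.log_neg hdk0 hdk)) hl
  have hφ0 : φ r₀ = 0 := by
    have : -l * r₀ = Real.log (d / k) := by rw [hr₀]; field_simp
    simp only [hφ, this, Real.exp_log hdk0, sub_self]
  have hφne : ∀ r, r ≠ r₀ → φ r ≠ 0 := by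
    intro r hr h
    apply hr
    have h1 : Real.exp (-l * r) = Real.exp (-l * r₀) := by
      have := h.trans hφ0.symm
      simpa only [hφ, sub_left_inj] using this
    have := Real.exp_injective h1
    exact mul_left_cancel₀ (by linarith : -l ≠ 0) this
  -- With this shift m − c vanishes where φ does, so (m − c)²/φ stays continuous.
  set c := m r₀ with hc
  set v : ℝ → ℝ := fun r => Real.exp (-d * r) * (1 - Real.exp (-l * r)) with hv
  have hB0 : 0 ≤ B := (abs_nonneg _).trans (hgB 0)
  -- The first summand is the Picone term (m − c)² Pφ'/φ. The second accounts for passing from g to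
  -- m' and from m to m − c, using (m v / l)' = g e^{-(d+l)r} − (d/l) m v.
  set Q : ℝ → ℝ := fun r =>
    (m r - c) ^ 2 / φ r * (-(1 / l) * (v r * (1 - Real.exp (-l * r))))
      + (m r ^ 2 + 2 * k * c / d * m r) * (v r / l) with hQ
  set D : ℝ → ℝ := fun r => g r ^ 2 * Real.exp (-(d + l) * r)
    - 2 * (d + l) / l * (m r ^ 2 * v r) + 2 * k * c / d * (g r * Real.exp (-(d + l) * r)) with hD
  have hexp : ∀ r, Real.exp (-(d + l) * r) = Real.exp (-d * r) * Real.exp (-l * r) := fun r => by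
    rw [← Real.exp_add]; ring_nf
  have hsq : ∀ x, |x| ≤ B → |x ^ 2| ≤ B ^ 2 := fun x hx => by
    rw [abs_pow]; gcongr
  have hmc : ContinuousOn m (Ioi 0) := fun r hr => (hm r hr).continuousAt.continuousWithinAt
  have hdl : 0 < d + l := by positivity
  have i1 : IntegrableOn (fun r => g r ^ 2 * Real.exp (-(d + l) * r)) (Ioi 0) :=
    integrableOn_mul_exp_neg hdl (hg.pow 2).continuousOn fun x _ => hsq _ (hgB x)
  have i2 : IntegrableOn (fun r => m r ^ 2 * v r) (Ioi 0) := by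
    have := (integrableOn_mul_exp_neg hd (hmc.pow 2) fun x hx => hsq _ (hmB x hx)).sub
      (integrableOn_mul_exp_neg hdl (hmc.pow 2) fun x hx => hsq _ (hmB x hx))
    refine this.congr (ae_of_all _ fun r => ?_)
    simp only [Pi.sub_apply, hv, hexp, Pi.pow_apply]; ring
  have i3 : IntegrableOn (fun r => g r * Real.exp (-(d + l) * r)) (Ioi 0) :=
    integrableOn_mul_exp_neg hdl hg.continuousOn fun x _ => hgB x
  have j2 := i2.const_mul (2 * (d + l) / l)
  have j3 := i3.const_mul (2 * k * c / d)
  have iD : IntegrableOn D (Ioi 0) := (i1.sub j2).add j3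
  have hDint : ∫ r in Ioi 0, D r = (∫ r in Ioi 0, g r ^ 2 * Real.exp (-(d + l) * r))
      - 2 * (d + l) / l * (∫ r in Ioi 0, m r ^ 2 * v r) := by
    refine (integral_add (i1.sub j2) j3).trans ?_
    rw [integral_sub' i1 j2,
      integral_const_mul, integral_const_mul, hg0]
    ring
  have hlt : ∀ r, 0 < r → Real.exp (-l * r) < 1 := fun r hr =>
    Real.exp_zero ▸ Real.exp_lt_exp.2 (by nlinarith)
  have hφd : ∀ r, HasDerivAt φ (-l * Real.exp (-l * r)) r := fun r =>
    (hasDerivAt_exp_neg_mul l r).sub_const _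
  have hvd : ∀ r, HasDerivAt v (-d * Real.exp (-d * r) * (1 - Real.exp (-l * r))
      + Real.exp (-d * r) * (l * Real.exp (-l * r))) r := fun r =>
    ((hasDerivAt_exp_neg_mul d r).mul ((hasDerivAt_exp_neg_mul l r).const_sub 1)).congr_deriv
      (by ring)
  have hvc : Continuous v := continuous_iff_continuousAt.2 fun r => (hvd r).continuousAt
  have hφc : Continuous φ := continuous_iff_continuousAt.2 fun r => (hφd r).continuousAt
  have hQd : ∀ r, 0 < r → r ≠ r₀ → ∃ q, HasDerivAt Q q r ∧ q ≤ D r := by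
    intro r hr hrr
    -- This is the Sturm–Liouville equation for φ, since Pφ' = −v (1 − e^{-lr}) / l.
    have hE : HasDerivAt (fun r => v r * (1 - Real.exp (-l * r))) (k * (v r * φ r)) r := by
      refine ((hvd r).mul ((hasDerivAt_exp_neg_mul l r).const_sub 1)).congr_deriv ?_
      simp only [hv, hφ]
      field_simp
      rw [hk]
      ring
    have h1 := ((((hm r hr).sub_const c).pow 2).div (hφd r) (hφne r hrr)).mul
      (hE.const_mul (-(1 / l)))
    have h2 := ((((hm r hr).pow 2)).add ((hm r hr).const_mul (2 * k * c / d))).mul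
      ((hvd r).div_const l)
    refine ⟨_, h1.add h2, ?_⟩
    have hone : 0 < 1 - Real.exp (-l * r) := by linarith [hlt r hr]
    have hφr := hφne r hrr
    have hX := Real.exp_pos (-d * r)
    have he := Real.exp_pos (-l * r)
    -- D − Q' is exactly this sum: the Picone square P (m' − (m − c) φ'/φ)², and the remainder k c²
    -- v / l left by the shift.
    have hpos : 0 ≤ Real.exp (-d * r) * (1 - Real.exp (-l * r)) ^ 2 /
        (l ^ 2 * Real.exp (-l * r)) * (l * Real.exp (-l * r) * (g r - m r) /
          (1 - Real.exp (-l * r)) + l * Real.exp (-l * r) * (m r - c) / φ r) ^ 2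
        + k * c ^ 2 * (Real.exp (-d * r) * (1 - Real.exp (-l * r))) / l := by positivity
    refine le_of_sub_nonneg (hpos.trans (le_of_eq ?_))
    simp only [hD, hexp, Pi.pow_apply, Pi.div_apply, Pi.add_apply, hv]
    generalize φ r = y at *
    generalize Real.exp (-d * r) = X at *
    generalize Real.exp (-l * r) = e at *
    have hone' := hone.ne'
    field_simp
    rw [hk]
    ring
  have hQc : ContinuousOn Q (Ici 0) := by
    intro r hr
    rcases eq_or_lt_of_le (show (0:ℝ) ≤ r from hr) with rfl | hr
    · have hv0 : v 0 = 0 := by simp [hv]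
      have hQ0 : Q 0 = 0 := by simp [hQ, hv0]
      rw [← Ioi_insert, continuousWithinAt_insert_self, ContinuousWithinAt, hQ0]
      have hφ00 : φ 0 ≠ 0 := hφne 0 hr₀p.ne
      have t1 : Tendsto (fun r => (φ r)⁻¹ * (-(1 / l) * (v r * (1 - Real.exp (-l * r)))))
          (𝓝[>] 0) (𝓝 0) := by
        have : ContinuousAt (fun r => (φ r)⁻¹ * (-(1 / l) * (v r * (1 - Real.exp (-l * r))))) 0 :=
          (hφc.continuousAt.inv₀ hφ00).mul (by fun_prop)
        have := this.tendsto
        simp only [hv0, zero_mul, mul_zero] at this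
        exact this.mono_left nhdsWithin_le_nhds
      have t2 : Tendsto (fun r => v r / l) (𝓝[>] 0) (𝓝 0) := by
        have : Continuous fun r => v r / l := by fun_prop
        have := this.tendsto 0
        simp only [hv0, zero_div] at this
        exact this.mono_left nhdsWithin_le_nhds
      have b1 := bdd_le_mul_tendsto_zero' ((2 * B) ^ 2) (f := fun r => (m r - c) ^ 2) (by
        filter_upwards [self_mem_nhdsWithin] with r hr
        have : |m r - c| ≤ 2 * B := by
          linarith [abs_sub (m r) c, hmB r hr, hmB r₀ hr₀p]
        rw [abs_pow]; gcongr) t1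
      have b2 := bdd_le_mul_tendsto_zero' (B ^ 2 + |2 * k * c / d| * B)
        (f := fun r => m r ^ 2 + 2 * k * c / d * m r) (by
        filter_upwards [self_mem_nhdsWithin] with r hr
        refine (abs_add_le _ _).trans (add_le_add (hsq _ (hmB r hr)) ?_)
        rw [abs_mul]; gcongr; exact hmB r hr) t2
      have := b1.add b2
      rw [add_zero] at this
      refine this.congr fun r => ?_
      simp only [hQ]; ring
    · apply ContinuousAt.continuousWithinAt
      rcases eq_or_ne r r₀ with hrr | hrr
      · rw [hrr]
        have h1 : ContinuousAt (fun r => (m r - c) ^ 2 / φ r) r₀ :=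
          continuousAt_sq_div ((hm r₀ hr₀p).sub_const c) (sub_self _) (hφd r₀) hφ0
            (mul_ne_zero (by linarith) (Real.exp_pos _).ne')
        have h2 := (hm r₀ hr₀p).continuousAt
        exact (h1.mul (by fun_prop)).add (((h2.pow 2).add (h2.const_mul _)).mul (by fun_prop))
      · obtain ⟨q, hq, -⟩ := hQd r hr hrr
        exact hq.continuousAt
  have hint : ∀ a b, 0 ≤ a → IntegrableOn D (Icc a b) := fun a b ha => by
    rw [integrableOn_Icc_iff_integrableOn_Ioc]
    exact iD.mono_set fun x hx => lt_of_le_of_lt ha hx.1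
  -- The derivative of Q is known only away from r₀, so the comparison is made on each side of r₀
  -- and joined by continuity of Q.
  have hstep : ∀ a b, 0 ≤ a → a ≤ b → r₀ ∉ Ioo a b → Q b - Q a ≤ ∫ r in a..b, D r := by
    intro a b ha hab hr
    have hex : ∀ x, ∃ q, x ∈ Ioo a b → HasDerivAt Q q x ∧ q ≤ D x := fun x => by
      by_cases hx : x ∈ Ioo a b
      · obtain ⟨q, hq⟩ := hQd x (ha.trans_lt hx.1) (fun h => hr (h ▸ hx))
        exact ⟨q, fun _ => hq⟩
      · exact ⟨0, fun h => absurd h hx⟩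
    choose q hq using hex
    exact intervalIntegral.sub_le_integral_of_hasDeriv_right_of_le hab
      (hQc.mono fun x hx => ha.trans hx.1) (fun x hx => (hq x hx).1.hasDerivWithinAt)
      (hint a b ha) fun x hx => (hq x hx).2
  have hle : ∀ R, r₀ ≤ R → Q R ≤ ∫ r in (0:ℝ)..R, D r := fun R hR => by
    have h1 := hstep 0 r₀ le_rfl hr₀p.le (by simp)
    have h2 := hstep r₀ R hr₀p.le hR (by simp)
    have hQ0 : Q 0 = 0 := by simp [hQ, hv]
    have hii : ∀ a b, 0 ≤ a → a ≤ b → IntervalIntegrable D volume a b := fun a b ha hab =>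
      (intervalIntegrable_iff_integrableOn_Icc_of_le hab).2 (hint a b ha)
    rw [← intervalIntegral.integral_add_adjacent_intervals (hii 0 r₀ le_rfl hr₀p.le)
      (hii r₀ R hr₀p.le hR)]
    linarith
  have hQt : Tendsto Q atTop (𝓝 0) := by
    have te := tendsto_exp_neg_mul_atTop hl
    have tv : Tendsto v atTop (𝓝 0) := by
      have := (tendsto_exp_neg_mul_atTop hd).mul (te.const_sub 1)
      rwa [zero_mul] at this
    have tφ : Tendsto φ atTop (𝓝 (0 - d / k)) := te.sub_const _
    have t1 : Tendsto (fun r => (φ r)⁻¹ * (-(1 / l) * (v r * (1 - Real.exp (-l * r)))))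
        atTop (𝓝 0) := by
      simpa using (tφ.inv₀ (by simpa using hdk0.ne')).mul
        ((tv.mul (te.const_sub 1)).const_mul (-(1 / l)))
    have t2 : Tendsto (fun r => v r / l) atTop (𝓝 0) := by simpa using tv.div_const l
    have b1 := bdd_le_mul_tendsto_zero' ((2 * B) ^ 2) (f := fun r => (m r - c) ^ 2) (by
      filter_upwards [eventually_gt_atTop 0] with r hr
      have : |m r - c| ≤ 2 * B := by
        linarith [abs_sub (m r) c, hmB r hr, hmB r₀ hr₀p]
      rw [abs_pow]; gcongr) t1
    have b2 := bdd_le_mul_tendsto_zero' (B ^ 2 + |2 * k * c / d| * B)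
      (f := fun r => m r ^ 2 + 2 * k * c / d * m r) (by
      filter_upwards [eventually_gt_atTop 0] with r hr
      refine (abs_add_le _ _).trans (add_le_add (hsq _ (hmB r hr)) ?_)
      rw [abs_mul]; gcongr; exact hmB r hr) t2
    have := b1.add b2
    rw [add_zero] at this
    refine this.congr fun r => ?_
    simp only [hQ]; ring
  have hlim := le_of_tendsto_of_tendsto hQt
    (intervalIntegral_tendsto_integral_Ioi 0 iD tendsto_id)
    ((eventually_ge_atTop r₀).mono fun R hR => hle R hR)
  rw [hDint] at hlim
  linarith

end Poincare

/-! ### Exponential laws and slice averages as integrals on the half-line -/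

section ExpDist

open Filter Topology Set

lemma lintegral_expDist (r : ℝ) {h : ℝ≥0 → ℝ≥0∞} (hh : Measurable h) :
    ∫⁻ x, h x ∂(expDist r) =
      ∫⁻ x in Ioi (0 : ℝ), ENNReal.ofReal (r * Real.exp (-r * x)) * h x.toNNReal := by
  have hemb : MeasurableEmbedding ((↑) : ℝ≥0 → ℝ) :=
    MeasurableEmbedding.subtype_coe measurableSet_Ici
  have hh' : Measurable fun x : ℝ => h x.toNNReal := hh.comp measurable_real_toNNReal
  have h1 : ∫⁻ x, h x ∂(expDist r) = ∫⁻ x in Ici (0 : ℝ), h x.toNNReal ∂(expMeasure r) := by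
    have hr : range ((↑) : ℝ≥0 → ℝ) = Ici 0 := by
      ext x; exact ⟨fun ⟨y, hy⟩ => hy ▸ y.2, fun hx => ⟨⟨x, hx⟩, rfl⟩⟩
    rw [← hr, ← hemb.map_comap, hemb.lintegral_map]
    simp [expDist]
  have h2 : expMeasure r = volume.withDensity (gammaPDF 1 r) := rfl
  have h3 : Measurable (gammaPDF 1 r) := (measurable_gammaPDFReal 1 r).ennreal_ofReal
  rw [h1, h2, restrict_withDensity measurableSet_Ici,
    lintegral_withDensity_eq_lintegral_mul _ h3 hh', restrict_Ioi_eq_restrict_Ici]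
  refine setLIntegral_congr_fun measurableSet_Ici fun x hx => ?_
  have : gammaPDF 1 r x = exponentialPDF r x := rfl
  simp only [Pi.mul_apply]
  rw [this, exponentialPDF_of_nonneg hx, neg_mul]

lemma expDist_eq_map (r : ℝ) :
    expDist r = ((volume.restrict (Ioi (0 : ℝ))).withDensity
      fun x => ENNReal.ofReal (r * Real.exp (-r * x))).map Real.toNNReal := by
  refine Measure.ext_of_lintegral _ fun h hh => ?_
  rw [lintegral_expDist r hh, lintegral_map hh measurable_real_toNNReal,
    lintegral_withDensity_eq_lintegral_mul _ (by fun_prop)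
      (g := fun x : ℝ => h x.toNNReal) (hh.comp measurable_real_toNNReal)]
  rfl

lemma integral_expDist {r : ℝ} (hr : 0 < r) {f : ℝ≥0 → ℝ} (hf : Measurable f) :
    ∫ x, f x ∂(expDist r) =
      r * ∫ x in Ioi (0 : ℝ), f x.toNNReal * Real.exp (-r * x) := by
  rw [expDist_eq_map, integral_map measurable_real_toNNReal.aemeasurable
    hf.aestronglyMeasurable, integral_withDensity_eq_integral_toReal_smul (by fun_prop)
    (ae_of_all _ fun x => ENNReal.ofReal_lt_top), ← integral_const_mul]
  refine integral_congr_ae (ae_of_all _ fun x => ?_)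
  simp only [smul_eq_mul]
  rw [ENNReal.toReal_ofReal (by positivity)]
  ring

lemma isProbabilityMeasure_expDist {r : ℝ} (hr : 0 < r) : IsProbabilityMeasure (expDist r) := by
  have := isProbabilityMeasure_expMeasure hr
  refine ⟨?_⟩
  have h1 := lintegral_expDist r (h := fun _ => 1) measurable_const
  rw [lintegral_one] at h1
  rw [h1]
  simp only [mul_one]
  rw [← ofReal_integral_eq_lintegral_ofReal
    ((integrableOn_exp_mul_Ioi (by linarith) 0).const_mul r) (ae_of_all _ fun x => by positivity),
    integral_const_mul, integral_exp_mul_Ioi (by linarith)]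
  simp [hr.ne']

lemma expDist_eq_withDensity {α lam : ℝ} (hα : 0 < α) (hlam : 0 < lam) :
    expDist α = ENNReal.ofReal (α / lam) •
      (expDist lam).withDensity fun x => ENNReal.ofReal (expRatio α lam x) := by
  have hm := (measurable_expRatio α lam).ennreal_ofReal
  refine Measure.ext_of_lintegral _ fun h hh => ?_
  rw [lintegral_smul_measure, lintegral_withDensity_eq_lintegral_mul _ hm hh,
    lintegral_expDist _ hh, lintegral_expDist _ (hm.mul hh), smul_eq_mul,
    ← lintegral_const_mul' _ _ ENNReal.ofReal_ne_top]
  refine setLIntegral_congr_fun measurableSet_Ioi fun x hx => ?_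
  simp only [Pi.mul_apply, expRatio, Real.coe_toNNReal x (le_of_lt hx)]
  rw [← mul_assoc, ← mul_assoc, ← ENNReal.ofReal_mul (by positivity),
    ← ENNReal.ofReal_mul (by positivity)]
  congr 2
  rw [show -α * x = -lam * x + -(α - lam) * x by ring, Real.exp_add]
  field_simp

lemma setIntegral_expDist {r : ℝ} (hr : 0 < r) {f : ℝ≥0 → ℝ} (hf : Measurable f) {s : Set ℝ}
    (hs : MeasurableSet s) :
    ∫ x in {x : ℝ≥0 | (x : ℝ) ∈ s}, f x ∂(expDist r) =
      r * ∫ x in s ∩ Ioi (0 : ℝ), f x.toNNReal * Real.exp (-r * x) := by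
  have hs' : MeasurableSet {x : ℝ≥0 | (x : ℝ) ∈ s} := measurable_subtype_coe hs
  rw [← integral_indicator hs', integral_expDist hr (hf.indicator hs'),
    ← Measure.restrict_restrict hs, ← integral_indicator hs]
  congr 1
  refine setIntegral_congr_fun measurableSet_Ioi fun x hx => ?_
  have hx' : ((x.toNNReal : ℝ≥0) : ℝ) = x := Real.coe_toNNReal x (le_of_lt hx)
  by_cases hxs : x ∈ s
  · have : x.toNNReal ∈ {x : ℝ≥0 | (x : ℝ) ∈ s} := by simpa [hx'] using hxs
    simp only [indicator_of_mem this, indicator_of_mem hxs]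
  · have : x.toNNReal ∉ {x : ℝ≥0 | (x : ℝ) ∈ s} := by simpa [hx'] using hxs
    simp only [indicator_of_notMem this, indicator_of_notMem hxs, zero_mul]

lemma integral_zero_exp_neg {r : ℝ} (hr : 0 < r) (a : ℝ) :
    r * ∫ x in (0 : ℝ)..a, Real.exp (-r * x) = 1 - Real.exp (-r * a) := by
  have : ∀ x ∈ uIcc 0 a, HasDerivAt (fun x => -Real.exp (-r * x) / r) (Real.exp (-r * x)) x :=
    fun x _ => ((hasDerivAt_exp_neg_mul r x).neg.div_const r).congr_deriv (by field_simp)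
  rw [intervalIntegral.integral_eq_sub_of_hasDerivAt this
    (by apply Continuous.intervalIntegrable; fun_prop)]
  simp only [mul_zero, Real.exp_zero]
  field_simp
  ring

lemma expDist_real_lt {r : ℝ} (hr : 0 < r) {a : ℝ} (ha : 0 ≤ a) :
    (expDist r).real {x : ℝ≥0 | (x : ℝ) < a} = 1 - Real.exp (-r * a) := by
  have h := setIntegral_expDist hr (f := fun _ => 1) measurable_const (s := Iio a) measurableSet_Iio
  rw [setIntegral_const, smul_eq_mul, mul_one] at h
  rw [← integral_zero_exp_neg hr, intervalIntegral.integral_of_le ha,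
    integral_Ioc_eq_integral_Ioo]
  refine h.trans ?_
  simp only [one_mul]
  rw [Iio_inter_Ioi]

lemma expDist_real_gt {r : ℝ} (hr : 0 < r) {a : ℝ} (ha : 0 ≤ a) :
    (expDist r).real {x : ℝ≥0 | a < (x : ℝ)} = Real.exp (-r * a) := by
  have h := setIntegral_expDist hr (f := fun _ => 1) measurable_const (s := Ioi a) measurableSet_Ioi
  rw [setIntegral_const, smul_eq_mul, mul_one] at h
  refine h.trans ?_
  simp only [one_mul]
  rw [Ioi_inter_Ioi, sup_eq_left.2 ha, integral_exp_mul_Ioi (by linarith)]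
  field_simp

lemma integral_sliceMeasure {X : Type*} [MeasurableSpace X] (ν : Measure X) (ϖ : X → ℝ) (g : X → ℝ)
    (t : ℝ) : ∫ x, g x ∂(sliceMeasure ν ϖ t) =
      (∫ x in slice ϖ t, g x ∂ν) / ν.real (slice ϖ t) := by
  rw [sliceMeasure, ProbabilityTheory.cond, integral_smul_measure, ENNReal.toReal_inv,
    smul_eq_mul, inv_mul_eq_div, measureReal_def]

lemma integral_levelMeasure {X : Type*} [MeasurableSpace X] (ν : Measure X) [IsFiniteMeasure ν]
    (ϖ : X → ℝ) {z : ℝ} (hz : 0 ≤ z) (F : ℝ → ℝ) :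
    ∫ t, F t ∂(levelMeasure ν ϖ (ENNReal.ofReal z)) =
      z * ∫ t in Ioi 0, ν.real (slice ϖ t) * F t := by
  rw [levelMeasure, integral_withDensity_eq_integral_toReal_smul
    ((measurable_measure_slice ν ϖ).const_mul _)
    (ae_of_all _ fun t => ENNReal.mul_lt_top ENNReal.ofReal_lt_top (measure_lt_top _ _)),
    ← integral_const_mul]
  refine integral_congr_ae (ae_of_all _ fun t => ?_)
  simp only [smul_eq_mul, ENNReal.toReal_mul, ENNReal.toReal_ofReal hz, measureReal_def, mul_assoc]

lemma abs_integral_sliceMeasure_le {X : Type*} [MeasurableSpace X] (ν : Measure X) (ϖ : X → ℝ)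
    {g : X → ℝ} {B : ℝ} (hB0 : 0 ≤ B) (hB : ∀ x, |g x| ≤ B) (t : ℝ) :
    |∫ x, g x ∂(sliceMeasure ν ϖ t)| ≤ B := by
  have : IsFiniteMeasure (sliceMeasure ν ϖ t) := inferInstanceAs (IsFiniteMeasure ν[|slice ϖ t])
  have h : (sliceMeasure ν ϖ t).real univ ≤ 1 := measureReal_le_one (μ := ν[|slice ϖ t])
  refine (norm_integral_le_of_norm_le_const (f := g) (C := B) (ae_of_all _ hB)).trans ?_
  exact mul_le_of_le_one_right hB0 h

end ExpDist

/-! ### Slices of the exponential ratio and the three cases -/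

section ExpSlice

open Filter Topology Set

variable {α lam : ℝ}

lemma slice_expRatio_backward (h : lam < α) (r : ℝ) :
    slice (expRatio α lam) (Real.exp (-(α - lam) * r)) = {x : ℝ≥0 | (x : ℝ) ∈ Iio r} := by
  ext x
  simp only [slice, expRatio, mem_ofPred_eq, Real.exp_lt_exp, mem_Iio]
  rw [mul_lt_mul_left_of_neg (by linarith)]

lemma slice_expRatio_forward (h : α < lam) (r : ℝ) :
    slice (expRatio α lam) (Real.exp ((lam - α) * r)) = {x : ℝ≥0 | (x : ℝ) ∈ Ioi r} := by
  ext x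
  simp only [slice, expRatio, mem_ofPred_eq, Real.exp_lt_exp, mem_Ioi]
  rw [neg_sub, mul_lt_mul_iff_right₀ (by linarith)]

lemma image_exp_neg_Ioi {d : ℝ} (hd : 0 < d) :
    (fun r : ℝ => Real.exp (-d * r)) '' Ioi 0 = Ioo 0 1 := by
  ext t
  constructor
  · rintro ⟨r, hr, rfl⟩
    exact ⟨Real.exp_pos _, by
      rw [← Real.exp_zero]; exact Real.exp_lt_exp.2 (by nlinarith [show 0 < r from hr])⟩
  · rintro ⟨h0, h1⟩
    refine ⟨-Real.log t / d, div_pos (neg_pos.2 (Real.log_neg h0 h1)) hd, ?_⟩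
    simp only
    rw [show -d * (-Real.log t / d) = Real.log t by field_simp, Real.exp_log h0]

lemma image_exp_Ici {k : ℝ} (hk : 0 < k) :
    (fun r : ℝ => Real.exp (k * r)) '' Ici 0 = Ici 1 := by
  ext t
  constructor
  · rintro ⟨r, hr, rfl⟩
    exact Real.one_le_exp (mul_nonneg hk.le hr)
  · intro h1
    have h1' : (1 : ℝ) ≤ t := h1
    refine ⟨Real.log t / k, div_nonneg (Real.log_nonneg h1') hk.le, ?_⟩
    simp only
    rw [show k * (Real.log t / k) = Real.log t by field_simp, Real.exp_log (by linarith)]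

lemma hasDerivAt_exp_mul (a x : ℝ) :
    HasDerivAt (fun x => Real.exp (a * x)) (a * Real.exp (a * x)) x := by
  simpa using hasDerivAt_exp_neg_mul (-a) x

/-- With d = α − λ, the substitution t = e^{-dr} turns the slice at level t into [0, r) and the
level law into a multiple of e^{-dr}(1 − e^{-λr}) dr. The estimate is then `backward_average_le`. -/
lemma slice_average_le_of_gt (hlam : 0 < lam) (h : lam < α) {g : ℝ≥0 → ℝ} (hg : Continuous g)
    {B : ℝ} (hB : ∀ x, |g x| ≤ B) (hg0 : ∫ x, g x ∂(expDist α) = 0) :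
    ∫ t, (∫ x, g x ∂(sliceMeasure (expDist lam) (expRatio α lam) t)) ^ 2
      ∂(levelMeasure (expDist lam) (expRatio α lam) (ENNReal.ofReal (α / lam))) ≤
      (α - lam) / (2 * α) * ∫ x, g x ^ 2 ∂(expDist α) := by
  have hα : 0 < α := hlam.trans h
  have := isProbabilityMeasure_expDist hlam
  obtain ⟨d, hd⟩ : ∃ d, d = α - lam := ⟨_, rfl⟩
  have hd0 : 0 < d := by rw [hd]; linarith
  set M : ℝ → ℝ := fun t => ∫ x, g x ∂(sliceMeasure (expDist lam) (expRatio α lam) t) with hM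
  set m : ℝ → ℝ := fun r => M (Real.exp (-d * r)) with hm
  set G : ℝ → ℝ := fun x => g x.toNNReal with hG
  have hB0 : 0 ≤ B := (abs_nonneg _).trans (hB 0)
  have hGc : Continuous G := hg.comp continuous_real_toNNReal
  have hreal : ∀ r, 0 < r → (expDist lam).real (slice (expRatio α lam) (Real.exp (-d * r))) =
      1 - Real.exp (-lam * r) := fun r hr => by
    rw [hd, slice_expRatio_backward h]
    exact expDist_real_lt hlam hr.le
  have hmr : ∀ r, 0 < r → m r =
      (∫ x in (0 : ℝ)..r, G x * (lam * Real.exp (-lam * x))) / (1 - Real.exp (-lam * r)) := by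
    intro r hr
    simp only [hm, hM]
    rw [integral_sliceMeasure, hreal r hr, hd, slice_expRatio_backward h,
      setIntegral_expDist hlam hg.measurable measurableSet_Iio, Iio_inter_Ioi,
      ← integral_Ioc_eq_integral_Ioo, ← intervalIntegral.integral_of_le hr.le,
      ← intervalIntegral.integral_const_mul]
    congr 2
    ext x
    simp only [hG]
    ring
  have hlt : ∀ r, 0 < r → 0 < 1 - Real.exp (-lam * r) := fun r hr => by
    have : Real.exp (-lam * r) < Real.exp 0 := Real.exp_lt_exp.2 (by nlinarith)
    rw [Real.exp_zero] at this
    linarith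
  have hmd : ∀ r, 0 < r → HasDerivAt m
      (lam * Real.exp (-lam * r) * (G r - m r) / (1 - Real.exp (-lam * r))) r := by
    intro r hr
    have hN : HasDerivAt (fun r => ∫ x in (0 : ℝ)..r, G x * (lam * Real.exp (-lam * x)))
        (G r * (lam * Real.exp (-lam * r))) r :=
      (by fun_prop : Continuous fun x => G x * (lam * Real.exp (-lam * x))).integral_hasStrictDerivAt
        0 r |>.hasDerivAt
    have h1 := hN.div ((hasDerivAt_exp_neg_mul lam r).const_sub 1) (hlt r hr).ne'
    have h2 := h1.congr_of_eventuallyEq (f₁ := m)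
      ((eventually_gt_nhds hr).mono fun s hs => hmr s hs)
    refine h2.congr_deriv ?_
    rw [hmr r hr]
    have := (hlt r hr).ne'
    generalize (∫ x in (0 : ℝ)..r, G x * (lam * Real.exp (-lam * x))) = N
    generalize Real.exp (-lam * r) = e at *
    field_simp
  have hG0 : ∫ r in Ioi 0, G r * Real.exp (-(d + lam) * r) = 0 := by
    rw [integral_expDist hα hg.measurable] at hg0
    rw [hd, sub_add_cancel]
    exact (mul_eq_zero.1 hg0).resolve_left hα.ne'
  have hkey := backward_average_le hlam hd0 hGc (fun r => hB _) hmd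
    (fun r _ => abs_integral_sliceMeasure_le _ _ hB0 hB _) hG0
  have hL : ∫ t, M t ^ 2 ∂(levelMeasure (expDist lam) (expRatio α lam)
      (ENNReal.ofReal (α / lam))) = α / lam * (d *
      ∫ r in Ioi 0, m r ^ 2 * (Real.exp (-d * r) * (1 - Real.exp (-lam * r)))) := by
    rw [integral_levelMeasure _ _ (by positivity)]
    congr 1
    -- Levels t ≥ 1 have empty slices, since ϖ ≤ 1 here.
    have hsub : ∫ t in Ioi 0, (expDist lam).real (slice (expRatio α lam) t) * M t ^ 2 =
        ∫ t in Ioo 0 1, (expDist lam).real (slice (expRatio α lam) t) * M t ^ 2 := by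
      refine (setIntegral_eq_of_subset_of_forall_sdiff_eq_zero measurableSet_Ioi
        Ioo_subset_Ioi_self fun t ht => ?_)
      have ht1 : 1 ≤ t := by
        by_contra hlt1
        exact ht.2 ⟨ht.1, not_le.1 hlt1⟩
      have : slice (expRatio α lam) t = ∅ := by
        ext x
        simp only [slice, expRatio, mem_ofPred_eq, mem_empty_iff_false, iff_false, not_lt]
        refine le_trans ?_ ht1
        rw [← Real.exp_zero]
        exact Real.exp_le_exp.2 (by nlinarith [x.2])
      simp [this]
    rw [hsub, ← image_exp_neg_Ioi hd0, integral_image_eq_integral_abs_deriv_smul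
      measurableSet_Ioi (fun r _ => (hasDerivAt_exp_neg_mul d r).hasDerivWithinAt)
      (fun x _ y _ hxy => mul_left_cancel₀ (by linarith : -d ≠ 0) (Real.exp_injective hxy)),
      ← integral_const_mul]
    refine setIntegral_congr_fun measurableSet_Ioi fun r hr => ?_
    simp only [smul_eq_mul]
    rw [hreal r hr, abs_mul, abs_neg, abs_of_pos hd0, abs_of_pos (Real.exp_pos _)]
    ring
  rw [hL, integral_expDist hα (hg.measurable.pow_const 2)]
  have hdl : d + lam = α := by rw [hd]; ring
  rw [hdl] at hkey
  rw [← hd]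
  calc _ = d / 2 * (2 * α / lam * ∫ r in Ioi 0, m r ^ 2 *
        (Real.exp (-d * r) * (1 - Real.exp (-lam * r)))) := by ring
    _ ≤ d / 2 * ∫ r in Ioi 0, G r ^ 2 * Real.exp (-α * r) := by gcongr
    _ = _ := by field_simp; rfl

/-- With k = λ − α, levels t = e^{kr} ≥ 1 have slice (r, ∞) and contribute k ∫ m² e^{-αr} dr. Levels
below 1 have the whole space as slice and contribute m(0)². The sum is what `forward_average_le`
bounds. -/
lemma slice_average_le_of_lt (hα : 0 < α) (h : α < lam) {g : ℝ≥0 → ℝ} (hg : Continuous g)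
    {B : ℝ} (hB : ∀ x, |g x| ≤ B) (hg0 : ∫ x, g x ∂(expDist α) = 0) :
    ∫ t, (∫ x, g x ∂(sliceMeasure (expDist lam) (expRatio α lam) t)) ^ 2
      ∂(levelMeasure (expDist lam) (expRatio α lam) (ENNReal.ofReal (α / lam))) ≤
      4 * lam * (lam - α) / (2 * lam - α) ^ 2 * ∫ x, g x ^ 2 ∂(expDist α) := by
  have hlam : 0 < lam := hα.trans h
  have := isProbabilityMeasure_expDist hlam
  obtain ⟨k, hk⟩ : ∃ k, k = lam - α := ⟨_, rfl⟩
  have hk0 : 0 < k := by rw [hk]; linarith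
  set ν := expDist lam
  set M : ℝ → ℝ := fun t => ∫ x, g x ∂(sliceMeasure ν (expRatio α lam) t) with hM
  set G : ℝ → ℝ := fun x => g x.toNNReal with hG
  set C := ∫ x in Ioi (0 : ℝ), G x * Real.exp (-lam * x) with hC
  -- This formula makes sense for every real r and agrees with the slice average for r ≥ 0, so m is
  -- differentiable at 0 as well.
  set m : ℝ → ℝ := fun r => lam * Real.exp (lam * r) *
    (C - ∫ x in (0 : ℝ)..r, G x * Real.exp (-lam * x)) with hm
  have hB0 : 0 ≤ B := (abs_nonneg _).trans (hB 0)
  have hGc : Continuous G := hg.comp continuous_real_toNNReal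
  have hreal : ∀ r, 0 ≤ r → ν.real (slice (expRatio α lam) (Real.exp (k * r))) =
      Real.exp (-lam * r) := fun r hr => by
    rw [hk, slice_expRatio_forward h]
    exact expDist_real_gt hlam hr
  have hGi : IntegrableOn (fun x => G x * Real.exp (-lam * x)) (Ioi 0) :=
    integrableOn_mul_exp_neg hlam hGc.continuousOn fun x _ => hB _
  have hmr : ∀ r, 0 ≤ r → m r = M (Real.exp (k * r)) := by
    intro r hr
    simp only [hm, hM]
    rw [integral_sliceMeasure, hreal r hr, hk, slice_expRatio_forward h,
      setIntegral_expDist hlam hg.measurable measurableSet_Ioi, Ioi_inter_Ioi, sup_eq_left.2 hr,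
      hC, ← intervalIntegral.integral_Ioi_sub_Ioi hGi hr, neg_mul lam r, Real.exp_neg]
    field_simp
    exact sub_sub_cancel _ _
  have hmd : ∀ r, HasDerivAt m ((α + k) * (m r - G r)) r := by
    intro r
    have hN : HasDerivAt (fun r => ∫ x in (0 : ℝ)..r, G x * Real.exp (-lam * x))
        (G r * Real.exp (-lam * r)) r :=
      (by fun_prop : Continuous fun x => G x * Real.exp (-lam * x)).integral_hasStrictDerivAt
        0 r |>.hasDerivAt
    refine (((hasDerivAt_exp_mul lam r).const_mul lam).mul (hN.const_sub C)).congr_deriv ?_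
    rw [show α + k = lam by rw [hk]; ring, neg_mul lam r, Real.exp_neg]
    simp only [hm]
    field_simp
    ring
  have hG0 : ∫ r in Ioi 0, G r * Real.exp (-α * r) = 0 := by
    rw [integral_expDist hα hg.measurable] at hg0
    exact (mul_eq_zero.1 hg0).resolve_left hα.ne'
  have hmB : ∀ r, 0 ≤ r → |m r| ≤ B := fun r hr => by
    rw [hmr r hr]; exact abs_integral_sliceMeasure_le _ _ hB0 hB _
  have hkey := forward_average_le hα hk0 hGc (fun r => hB _) hmd hmB hG0
  have hmc : Continuous m := continuous_iff_continuousAt.2 fun r => (hmd r).continuousAt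
  have hF1 : ∀ t ∈ Ioo (0 : ℝ) 1, ν.real (slice (expRatio α lam) t) * M t ^ 2 = m 0 ^ 2 := by
    have huniv : ∀ t, t < 1 → slice (expRatio α lam) t = univ := fun t ht => by
      ext x
      simp only [slice, expRatio, mem_ofPred_eq, mem_univ, iff_true]
      refine ht.trans_le (Real.one_le_exp ?_)
      nlinarith [x.2]
    have h0 : m 0 = ∫ x, g x ∂ν := by
      simp only [hm]
      rw [integral_expDist hlam hg.measurable, hC]
      simp [hG]
    intro t ht
    simp only [hM]
    rw [integral_sliceMeasure, huniv t ht.2, h0]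
    simp
  have hinj : InjOn (fun r : ℝ => Real.exp (k * r)) (Ici 0) := fun x _ y _ hxy =>
    mul_left_cancel₀ hk0.ne' (Real.exp_injective hxy)
  have hder : ∀ r ∈ Ici (0 : ℝ), HasDerivWithinAt (fun r : ℝ => Real.exp (k * r))
      (k * Real.exp (k * r)) (Ici 0) r := fun r _ => (hasDerivAt_exp_mul k r).hasDerivWithinAt
  have hF2 : ∀ r ∈ Ici (0 : ℝ), |k * Real.exp (k * r)| •
      (ν.real (slice (expRatio α lam) (Real.exp (k * r))) * M (Real.exp (k * r)) ^ 2) =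
      k * (m r ^ 2 * Real.exp (-α * r)) := fun r hr => by
    rw [hreal r hr, ← hmr r hr, abs_of_pos (by positivity), smul_eq_mul,
      show -α * r = k * r + -lam * r by rw [hk]; ring, Real.exp_add]
    ring
  have hi : IntegrableOn (fun r => k * (m r ^ 2 * Real.exp (-α * r))) (Ici 0) := by
    rw [integrableOn_Ici_iff_integrableOn_Ioi]
    exact (integrableOn_mul_exp_neg hα (hmc.pow 2).continuousOn (B := B ^ 2) fun x hx => by
      simp only [Pi.pow_apply]
      rw [abs_pow]; gcongr; exact hmB x (le_of_lt hx)).const_mul k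
  have hL : ∫ t, M t ^ 2 ∂(levelMeasure ν (expRatio α lam) (ENNReal.ofReal (α / lam))) =
      α / lam * (m 0 ^ 2 + k * ∫ r in Ioi 0, m r ^ 2 * Real.exp (-α * r)) := by
    obtain ⟨I, hI⟩ : ∃ I, I = ∫ r in Ioi 0, m r ^ 2 * Real.exp (-α * r) := ⟨_, rfl⟩
    rw [integral_levelMeasure _ _ (by positivity), ← hI]
    congr 1
    have hun : Ioi (0 : ℝ) = Ioo 0 1 ∪ Ici 1 := (Ioo_union_Ici_eq_Ioi one_pos).symm
    rw [hun, setIntegral_union (by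
        rw [Set.disjoint_left]; exact fun x hx hx' => absurd hx.2 (not_lt.2 hx')) measurableSet_Ici]
    · congr 1
      · rw [setIntegral_congr_fun measurableSet_Ioo hF1]
        simp
      · rw [← image_exp_Ici hk0, integral_image_eq_integral_abs_deriv_smul measurableSet_Ici hder
          hinj, setIntegral_congr_fun measurableSet_Ici hF2, integral_Ici_eq_integral_Ioi,
          integral_const_mul, hI]
    · exact (integrableOn_const (by simp)).congr_fun (fun t ht => (hF1 t ht).symm) measurableSet_Ioo
    · rw [← image_exp_Ici hk0, integrableOn_image_iff_integrableOn_abs_deriv_smul measurableSet_Ici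
        hder hinj]
      exact hi.congr_fun (fun r hr => (hF2 r hr).symm) measurableSet_Ici
  rw [hL, integral_expDist hα (hg.measurable.pow_const 2)]
  have hl : lam = α + k := by rw [hk]; ring
  rw [← hk, show 2 * lam - α = α + k + k by rw [hl]; ring]
  rw [hl]
  calc _ = α * k / (α + k) * (4 / (α + k + k) ^ 2) * ((α + k + k) ^ 2 / 4 *
        (m 0 ^ 2 / k + ∫ r in Ioi 0, m r ^ 2 * Real.exp (-α * r))) := by field_simp
    _ ≤ α * k / (α + k) * (4 / (α + k + k) ^ 2) *
        ((α + k) ^ 2 * ∫ r in Ioi 0, G r ^ 2 * Real.exp (-α * r)) := by gcongr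
    _ = _ := by simp only [hG]; field_simp

lemma slice_average_eq_zero {g : ℝ≥0 → ℝ} (hg0 : ∫ x, g x ∂(expDist α) = 0) (t : ℝ) :
    ∫ x, g x ∂(sliceMeasure (expDist α) (expRatio α α) t) = 0 := by
  rw [integral_sliceMeasure]
  by_cases ht : t < 1
  · have : slice (expRatio α α) t = univ := by
      ext x; simp [slice, expRatio, ht]
    rw [this, setIntegral_univ, hg0, zero_div]
  · have : slice (expRatio α α) t = ∅ := by
      ext x; simpa [slice, expRatio] using not_lt.1 ht
    simp [this]

/-- Shows that the infimum is over a nonempty set, as a lower bound on a real `sInf` requires. The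
witness is ±1, changing sign at the median log 2 / α. -/
lemma exists_normalized_centred (hα : 0 < α) : ∃ f : ℝ≥0 → ℝ, MemLp f 2 (expDist α) ∧
    ∫ x, f x ∂(expDist α) = 0 ∧ ∫ x, f x ^ 2 ∂(expDist α) = 1 := by
  have := isProbabilityMeasure_expDist hα
  set A : Set ℝ≥0 := {x : ℝ≥0 | (x : ℝ) < Real.log 2 / α} with hA
  have hAm : MeasurableSet A := measurableSet_lt (by fun_prop) measurable_const
  have hAr : (expDist α).real A = 1 / 2 := by
    rw [hA, expDist_real_lt hα (div_nonneg (Real.log_nonneg (by norm_num)) hα.le),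
      show -α * (Real.log 2 / α) = -Real.log 2 by field_simp, Real.exp_neg,
      Real.exp_log (by norm_num)]
    norm_num
  have hi : Integrable (A.indicator fun _ => (2 : ℝ)) (expDist α) :=
    (integrable_const 2).indicator hAm
  refine ⟨fun x => A.indicator (fun _ => 2) x - 1, ?_, ?_, ?_⟩
  · have h2 : MemLp (A.indicator fun _ => (2 : ℝ)) 2 (expDist α) :=
      memLp_indicator_const 2 hAm 2 (Or.inr (measure_ne_top _ _))
    exact h2.sub (memLp_const (1 : ℝ))
  · rw [integral_sub hi (integrable_const 1), integral_indicator_const _ hAm, hAr]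
    simp
  · have : ∀ x, (A.indicator (fun _ => (2 : ℝ)) x - 1) ^ 2 = 1 := fun x => by
      by_cases hx : x ∈ A
      · rw [indicator_of_mem hx]; norm_num
      · rw [indicator_of_notMem hx]; norm_num
    simp [this]

lemma le_infDirichletForm_expSlice (hα : 0 < α) (hlam : 0 < lam) {ρ : ℝ} (hρ : 0 ≤ ρ)
    (h : ∀ g : ℝ≥0 → ℝ, Continuous g → (∃ B, ∀ x, |g x| ≤ B) → ∫ x, g x ∂(expDist α) = 0 →
      ∫ t, (∫ x, g x ∂(sliceMeasure (expDist lam) (expRatio α lam) t)) ^ 2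
        ∂(levelMeasure (expDist lam) (expRatio α lam) (ENNReal.ofReal (α / lam))) ≤
        ρ * ∫ x, g x ^ 2 ∂(expDist α)) :
    1 - ρ ≤ infDirichletForm (expDist α) (expSlice α lam) := by
  have := isProbabilityMeasure_expDist hα
  have := isProbabilityMeasure_expDist hlam
  refine le_csInf ?_ ?_
  · obtain ⟨f, h1, h2, h3⟩ := exists_normalized_centred hα
    exact ⟨_, f, h1, h2, h3, rfl⟩
  · rintro e ⟨f, h1, h2, h3, rfl⟩
    have := le_dirichletForm_idealSlice (measurable_expRatio α lam) (fun x => Real.exp_pos _)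
      (expDist_eq_withDensity hα hlam) hρ h h1 h2
    rwa [h3, mul_one] at this

end ExpSlice

theorem propositionA1 (α lam : ℝ) (hα : 0 < α) (hlam : 0 < lam) :
    (if lam ≤ α then (α + lam) / (2 * α) else (α / (2 * lam - α)) ^ 2) ≤
      infDirichletForm (expDist α) (expSlice α lam) := by
  rcases lt_trichotomy lam α with h | h | h
  · rw [if_pos h.le, show (α + lam) / (2 * α) = 1 - (α - lam) / (2 * α) by field_simp; ring]
    exact le_infDirichletForm_expSlice hα hlam (div_nonneg (by linarith) (by linarith))
      fun g hg ⟨B, hB⟩ hg0 => slice_average_le_of_gt hlam h hg hB hg0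
  · subst h
    rw [if_pos le_rfl, show (lam + lam) / (2 * lam) = 1 - 0 by field_simp; ring]
    refine le_infDirichletForm_expSlice hlam hlam le_rfl fun g _ _ hg0 => ?_
    simp [slice_average_eq_zero hg0]
  · have h2 : 2 * lam - α ≠ 0 := by linarith
    rw [if_neg (not_le.2 h), show (α / (2 * lam - α)) ^ 2 =
      1 - 4 * lam * (lam - α) / (2 * lam - α) ^ 2 by field_simp; ring]
    exact le_infDirichletForm_expSlice hα hlam
      (div_nonneg (mul_nonneg (by linarith) (by linarith)) (sq_nonneg _))
      fun g hg ⟨B, hB⟩ hg0 => slice_average_le_of_lt hα h hg hB hg0
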